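/- Let $r\ge 1$ and $m\ge 0$ be integers and let $\mathbf n=(n_1,\dots,n_r)$ be an $r$-tuple of positive integers. Let $G(\mathbf n)=GL(n_1,\mathbb C)\times\cdots\times GL(n_r,\mathbb C)$ act on $V(\mathbf n)=\mathbb C^{n_1}\otimes\cdots\otimes\mathbb C^{n_r}$ by $(g_1,\dots,g_r)\cdot(v_1\otimes\cdots\otimes v_r)=g_1v_1\otimes\cdots\otimes g_rv_r$, on the dual space $V(\mathbf n)^*$ by the dual (contragredient) action, and diagonally on $\mathcal T^{2m}=\bigotimes^{2m}\bigl(V(\mathbf n)\oplus V(\mathbf n)^*\bigr)$. For a vector space $V$ put $V_0=V$ and $V_1=V^*$. For $b\in\{0,1\}^{2m}$ put $\mathbb T(\mathbf n,b)=\bigotimes_{k=1}^{2m}V(\mathbf n)_{b_k}$, a direct summand of $\mathcal T^{2m}$, and $T_n(b)=\bigotimes_{k=1}^{2m}(\mathbb C^n)_{b_k}$. Identify $V(\mathbf n)^*$ with $(\mathbb C^{n_1})^*\otimes\cdots\otimes(\mathbb C^{n_r})^*$, and let $\Phi^{b}_{\mathbf n}:\mathbb T(\mathbf n,b)\to T_{n_1}(b)\otimes\cdots\otimes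 T_{n_r}(b)$ be the isomorphism that groups together the tensor factors involving each $\mathbb C^{n_i}$. With $e_1,\dots,e_n$ the standard basis of $\mathbb C^n$ and $e^1,\dots,e^n$ its dual basis, put for $\sigma\in S_m$ $$t_n(\sigma)=\sum_{1\le j_1,\dots,j_m\le n}(e_{j_1}\otimes\cdots\otimes e_{j_m})\otimes(e^{j_{\sigma(1)}}\otimes\cdots\otimes e^{j_{\sigma(m)}})\in T_n(0^m1^m).$$ For an $m$-element subset $M$ of $\{1,\dots,2m\}$ let $b_M\in\{0,1\}^{2m}$ have entry $1$ exactly at the positions in $M$, fix any permutation $\gamma_M\in S_{2m}$ of the positions that carries $0^m1^m$ to $b_M$, and let $\Psi^M_n:T_n(0^m1^m)\to T_n(b_M)$ be the isomorphism that permutes the tensor factors by $\gamma_M$. For $\mathbf s=(\sigma_1,\dots,\sigma_r)\in S_m^r$ put $$\phi^M_{\mathbf n}(\mathbf s)=(\Phi^{b_M}_{\mathbf n})^{-1}\bigl(\Psi^M_{n_1}(t_{n_1}(\sigma_1))\otimes\cdots\otimes\Psi^M_{n_r}(t_{n_r}(\sigma_r))\bigr)\in\mathbb T(\mathbf n,b_M)\subseteq\mathcal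 T^{2m}.$$ Then, for every choice of the permutations $\gamma_M$: 1. The tensors $\phi^M_{\mathbf n}(\mathbf s)$, for $\mathbf s\in S_m^r$ and $M\subseteq\{1,\dots,2m\}$ with $|M|=m$, span the space of invariants $(\mathcal T^{2m})^{G(\mathbf n)}$. 2. If $n_i\ge m$ for all $i$, these tensors (indexed by the pairs $(M,\mathbf s)$) are linearly independent, so they form a basis of $(\mathcal T^{2m})^{G(\mathbf n)}$. 3. $\dim(\mathcal T^{2m})^{G(\mathbf n)}\le\binom{2m}{m}(m!)^r$, with equality if and only if $n_i\ge m$ for all $1\le i\le r$. -/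

import Mathlib

open scoped TensorProduct BigOperators

noncomputable section

namespace InvTensor

open Module

/-! ## The spaces `V_0 = V` and `V_1 = V^*` -/

/-- `V_b`: the space `V` for `b = 0` (`false`), its dual `V^*` for `b = 1` (`true`). -/
def Tw (V : Type) [AddCommGroup V] [Module ℂ V] : Bool → Type
  | false => V
  | true => Dual ℂ V

instance instAddCommGroupTw (V : Type) [AddCommGroup V] [Module ℂ V] (b : Bool) :
    AddCommGroup (Tw V b) :=
  match b with
  | false => inferInstanceAs (AddCommGroup V)
  | true => inferInstanceAs (AddCommGroup (Dual ℂ V))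

instance instModuleTw (V : Type) [AddCommGroup V] [Module ℂ V] (b : Bool) :
    Module ℂ (Tw V b) :=
  match b with
  | false => inferInstanceAs (Module ℂ V)
  | true => inferInstanceAs (Module ℂ (Dual ℂ V))

/-- The inclusion of `V_b` into `V ⊕ V^*`. -/
def twIncl (V : Type) [AddCommGroup V] [Module ℂ V] : (b : Bool) → Tw V b →ₗ[ℂ] V × Dual ℂ V
  | false => LinearMap.inl ℂ V (Dual ℂ V)
  | true => LinearMap.inr ℂ V (Dual ℂ V)

/-- The identity map `V_b → V_{b'}` when `b = b'`. -/
def twCast (V : Type) [AddCommGroup V] [Module ℂ V] {b b' : Bool} (h : b = b') :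
    Tw V b ≃ₗ[ℂ] Tw V b' :=
  h ▸ LinearEquiv.refl ℂ (Tw V b)

/-- The basis `e_1, …, e_n` of `ℂ^n` for `b = 0`, the dual basis `e^1, …, e^n` of `(ℂ^n)^*`
for `b = 1`. -/
def twBasis (n : ℕ) : (b : Bool) → Basis (Fin n) ℂ (Tw (Fin n → ℂ) b)
  | false => Pi.basisFun ℂ (Fin n)
  | true => (Pi.basisFun ℂ (Fin n)).dualBasis

/-! ## The representations -/

/-- The group `GL(n_1) × ⋯ × GL(n_r)`. -/
abbrev G {r : ℕ} (n : Fin r → ℕ) : Type := (i : Fin r) → GL (Fin (n i)) ℂ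

/-- The space `V(n) = ℂ^{n_1} ⊗ ⋯ ⊗ ℂ^{n_r}`. -/
abbrev V {r : ℕ} (n : Fin r → ℕ) : Type := ⨂[ℂ] i : Fin r, (Fin (n i) → ℂ)

/-- The space `⊗^d (V(n) ⊕ V(n)^*)`. -/
abbrev T {r : ℕ} (n : Fin r → ℕ) (d : ℕ) : Type := ⨂[ℂ]^d (V n × Dual ℂ (V n))

/-- The tensor product of a family of representations of a group `H`, with
`h • ⨂ v_i = ⨂ (h • v_i)`. -/
def piRep {ι : Type} {H : Type} [Group H] {W : ι → Type} [∀ i, AddCommGroup (W i)]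
    [∀ i, Module ℂ (W i)] (ρ : ∀ i, Representation ℂ H (W i)) :
    Representation ℂ H (⨂[ℂ] i, W i) where
  toFun h := PiTensorProduct.map fun i => ρ i h
  map_one' := by simp
  map_mul' g h := by
    simp only [map_mul]
    exact PiTensorProduct.map_mul _ _

/-- The defining representation of `GL(n)` on `ℂ^n`. -/
def stdRep (n : ℕ) : Representation ℂ (GL (Fin n) ℂ) (Fin n → ℂ) where
  toFun g := Matrix.toLin' (g : Matrix (Fin n) (Fin n) ℂ)
  map_one' := Matrix.toLin'_one
  map_mul' g h := Matrix.toLin'_mul (g : Matrix (Fin n) (Fin n) ℂ) (h : Matrix (Fin n) (Fin n) ℂ)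

/-- The outer action of `G(n)` on `V(n)`:
`(g_1, …, g_r) • (v_1 ⊗ ⋯ ⊗ v_r) = (g_1 v_1) ⊗ ⋯ ⊗ (g_r v_r)`. -/
def repV {r : ℕ} (n : Fin r → ℕ) : Representation ℂ (G n) (V n) :=
  piRep fun i => (stdRep (n i)).comp (Pi.evalMonoidHom (fun i => GL (Fin (n i)) ℂ) i)

/-- The inner action of `G(n)` on `⊗^d (V(n) ⊕ V(n)^*)`, where `V(n)^*` is the dual
representation. -/
def repT {r : ℕ} (n : Fin r → ℕ) (d : ℕ) : Representation ℂ (G n) (T n d) :=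
  piRep fun _ : Fin d => (repV n).prod (repV n).dual

/-- The `G(n)`-invariants in `⊗^d (V(n) ⊕ V(n)^*)`. -/
def invT {r : ℕ} (n : Fin r → ℕ) (d : ℕ) : Submodule ℂ (T n d) :=
  Representation.invariants (k := ℂ) (V := T n d) (repT n d)

theorem mem_invT {r : ℕ} (n : Fin r → ℕ) (d : ℕ) (x : T n d) :
    x ∈ invT n d ↔ ∀ g : G n, repT n d g x = x :=
  Iff.rfl

/-! ## Reordering of tensor factors -/

/-- The space `T_n(b) = ⨂_j (ℂ^n)_{b_j}`. -/
abbrev Tb (n : ℕ) {d : ℕ} (b : Fin d → Bool) : Type := ⨂[ℂ] j : Fin d, Tw (Fin n → ℂ) (b j)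

/-- The space `𝕋(n, b) = ⨂_j V(n)_{b_j}`. -/
abbrev TT {r : ℕ} (n : Fin r → ℕ) {d : ℕ} (b : Fin d → Bool) : Type :=
  ⨂[ℂ] j : Fin d, Tw (V n) (b j)

/-- The inclusion of the direct summand `𝕋(n, b)` into `⊗^d (V(n) ⊕ V(n)^*)`. -/
def inclT {r : ℕ} (n : Fin r → ℕ) {d : ℕ} (b : Fin d → Bool) : TT n b →ₗ[ℂ] T n d :=
  PiTensorProduct.map fun j => twIncl (V n) (b j)

/-- The canonical isomorphism `V(n)_b ≅ ⨂_i (ℂ^{n_i})_b`; for `b = 1` it is the inverse of the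
canonical isomorphism `⨂_i (ℂ^{n_i})^* ≅ V(n)^*`, under which
`(f_1 ⊗ ⋯ ⊗ f_r) (v_1 ⊗ ⋯ ⊗ v_r) = f_1 (v_1) ⋯ f_r (v_r)`. -/
def twSplit {r : ℕ} (n : Fin r → ℕ) :
    (b : Bool) → Tw (V n) b ≃ₗ[ℂ] ⨂[ℂ] i : Fin r, Tw (Fin (n i) → ℂ) b
  | false => LinearEquiv.refl ℂ (V n)
  | true => (PiTensorProduct.dualDistribEquiv (R := ℂ) (M := fun i : Fin r => Fin (n i) → ℂ)).symm

/-- The interchange `⨂_j ⨂_i (ℂ^{n_i})_{b_j} ≅ ⨂_i ⨂_j (ℂ^{n_i})_{b_j}`, given on the standard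
bases of the two sides; see `swap_tprod`. -/
def swap {r : ℕ} (n : Fin r → ℕ) {d : ℕ} (b : Fin d → Bool) :
    (⨂[ℂ] j : Fin d, ⨂[ℂ] i : Fin r, Tw (Fin (n i) → ℂ) (b j)) ≃ₗ[ℂ]
      ⨂[ℂ] i : Fin r, Tb (n i) b :=
  (Basis.piTensorProduct fun j => Basis.piTensorProduct fun i => twBasis (n i) (b j)).equiv
    (Basis.piTensorProduct fun i => Basis.piTensorProduct fun j => twBasis (n i) (b j))
    (Equiv.piComm _)

theorem swap_tprod {r : ℕ} (n : Fin r → ℕ) {d : ℕ} (b : Fin d → Bool)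
    (x : ∀ j i, Tw (Fin (n i) → ℂ) (b j)) :
    swap n b (⨂ₜ[ℂ] j, ⨂ₜ[ℂ] i, x j i) = ⨂ₜ[ℂ] i, ⨂ₜ[ℂ] j, x j i := by
  refine (Basis.piTensorProduct fun i => Basis.piTensorProduct
    fun j => twBasis (n i) (b j)).ext_elem fun p => ?_
  simp only [swap, Basis.equiv, LinearEquiv.trans_apply, Basis.reindex, LinearEquiv.symm_trans_apply,
    LinearEquiv.apply_symm_apply, Equiv.symm_symm, Finsupp.domLCongr_symm,
    Finsupp.domLCongr_apply, Finsupp.domCongr_apply, Finsupp.equivMapDomain_apply,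
    Basis.piTensorProduct_repr_tprod_apply]
  exact Finset.prod_comm

/-- The isomorphism `Φ : 𝕋(n, b) → T_{n_1}(b) ⊗ ⋯ ⊗ T_{n_r}(b)` that groups together the factors
involving `ℂ^{n_i}`; see `Phi_tprod`. -/
def Phi {r : ℕ} (n : Fin r → ℕ) {d : ℕ} (b : Fin d → Bool) :
    TT n b ≃ₗ[ℂ] ⨂[ℂ] i : Fin r, Tb (n i) b :=
  (PiTensorProduct.congr fun j => twSplit n (b j)) ≪≫ₗ swap n b

theorem Phi_tprod {r : ℕ} (n : Fin r → ℕ) {d : ℕ} (b : Fin d → Bool)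
    (x : ∀ j i, Tw (Fin (n i) → ℂ) (b j)) :
    Phi n b (⨂ₜ[ℂ] j, (twSplit n (b j)).symm (⨂ₜ[ℂ] i, x j i)) = ⨂ₜ[ℂ] i, ⨂ₜ[ℂ] j, x j i := by
  simp [Phi, swap_tprod]

/-! ## The invariant tensors -/

/-- The sequence `0^m 1^m`. -/
def b₀ (m : ℕ) : Fin (2 * m) → Bool := fun k => decide (m ≤ (k : ℕ))

/-- The `m`-element subsets of the `2m` positions. -/
abbrev Sub (m : ℕ) : Type := {M : Finset (Fin (2 * m)) // M.card = m}

/-- The sequence `b_M`, with entry `1` exactly at the positions in `M`. -/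
def bM {m : ℕ} (M : Sub m) : Fin (2 * m) → Bool := fun k => decide (k ∈ M.1)

/-- The permutations of the `2m` positions that carry `0^m 1^m` to `b_M`. -/
abbrev Shuffle {m : ℕ} (M : Sub m) : Type :=
  {γ : Equiv.Perm (Fin (2 * m)) // ∀ k, bM M (γ k) = b₀ m k}

instance instNonemptyShuffle {m : ℕ} (M : Sub m) : Nonempty (Shuffle M) := by
  have h1 : Fintype.card {k // bM M k = true} = m := by
    simp [bM, Fintype.card_subtype, M.2]
  have h2 : Fintype.card {k // b₀ m k = true} = m := by
    have e : {k : Fin (2 * m) // b₀ m k = true} ≃ Fin m :=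
      { toFun := fun k => ⟨k.1.1 - m, by
          have := k.1.2
          have h := k.2
          simp only [b₀, decide_eq_true_eq] at h
          omega⟩
        invFun := fun j => ⟨⟨j.1 + m, by omega⟩, by simp [b₀]⟩
        left_inv := fun k => by
          have h := k.2
          simp only [b₀, decide_eq_true_eq] at h
          ext
          simp only
          omega
        right_inv := fun j => by ext; simp }
    simpa using Fintype.card_congr e
  have e : {k // b₀ m k = true} ≃ {k // bM M k = true} :=
    Fintype.equivOfCardEq (h2.trans h1.symm)
  refine ⟨⟨e.extendSubtype, fun k => ?_⟩⟩
  by_cases hk : b₀ m k = true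
  · rw [hk]
    exact e.extendSubtype_mem k hk
  · have h := e.extendSubtype_not_mem k hk
    simp only [Bool.not_eq_true] at h hk
    rw [h, hk]

/-- The tensor
`t_n(σ) = ∑_{j_1, …, j_m} e_{j_1} ⊗ ⋯ ⊗ e_{j_m} ⊗ e^{j_{σ(1)}} ⊗ ⋯ ⊗ e^{j_{σ(m)}}`. -/
def t (n : ℕ) {m : ℕ} (σ : Equiv.Perm (Fin m)) : Tb n (b₀ m) :=
  ∑ J : Fin m → Fin n, ⨂ₜ[ℂ] k : Fin (2 * m), twBasis n (b₀ m k)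
    (if h : (k : ℕ) < m then J ⟨k, h⟩ else J (σ ⟨(k : ℕ) - m, by have := k.2; omega⟩))

/-- The isomorphism `Ψ : T_n(0^m 1^m) → T_n(b_M)` that permutes the tensor factors by `γ`: the
factor at position `k` moves to position `γ k`. -/
def Psi (n : ℕ) {m : ℕ} {M : Sub m} (γ : Shuffle M) : Tb n (b₀ m) ≃ₗ[ℂ] Tb n (bM M) :=
  PiTensorProduct.reindex ℂ (fun k => Tw (Fin n → ℂ) (b₀ m k)) γ.1 ≪≫ₗ
    PiTensorProduct.congr fun k => twCast (Fin n → ℂ)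
      (show b₀ m (γ.1.symm k) = bM M k by rw [← γ.2, Equiv.apply_symm_apply])

/-- The tensor `t^M_n(s) = Ψ(t_{n_1}(σ_1)) ⊗ ⋯ ⊗ Ψ(t_{n_r}(σ_r))` for `s = (σ_1, …, σ_r)`. -/
def tM {r : ℕ} (n : Fin r → ℕ) {m : ℕ} {M : Sub m} (γ : Shuffle M)
    (s : Fin r → Equiv.Perm (Fin m)) : ⨂[ℂ] i : Fin r, Tb (n i) (bM M) :=
  ⨂ₜ[ℂ] i, Psi (n i) γ (t (n i) (s i))

/-- The tensor `φ^M_n(s) = Φ⁻¹(t^M_n(s))`, as an element of `⊗^{2m} (V(n) ⊕ V(n)^*)`. -/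
def phi {r : ℕ} (n : Fin r → ℕ) {m : ℕ} {M : Sub m} (γ : Shuffle M)
    (s : Fin r → Equiv.Perm (Fin m)) : T n (2 * m) :=
  inclT n (bM M) ((Phi n (bM M)).symm (tM n γ s))

end InvTensor

end

noncomputable section

namespace InvTensor

open Module

/-! The argument is Schur–Weyl duality for the product group, carried out in coordinates. In each
scalar group element `twoGL` forces an invariant to live only in types with as many duals as vectors
(`isBalanced_of_mem_invT`), so an invariant is a family of components indexed by `M`. Reading the
positions through `γ` turns the component at `M` into a square matrix on multi-indices; the group
acts on it by conjugation with `⨂ g_i^{⊗m}` (`coeffMat_repT`), so invariance means commuting with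
all these matrices, and `phi` becomes a permutation matrix (`coeffMat_phi`).

Spanning is then a double commutant statement. A matrix commuting with every `Gam m g` commutes with
all matrices invariant under `S_m^r`, by density of invertible matrices (`commute_of_commute_Gam`);
Maschke and Jacobson density put it in the span of the permutation matrices (`exists_eq_sum_perm`).

If all `n_i ≥ m`, an injective multi-index separates the permutation matrices
(`linearIndependent_phi`). If some `n_i < m`, antisymmetrizing over `m` indices gives a nontrivial
relation (`sum_sign_permMat`). The dimension statement compares the size of the spanning family with
the rank of its span. -/

/-! ### Double commutant theorem for a finite permutation group -/

/-- The permutation representation on functions. -/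
def permRep {H X : Type} [Group H] (τ : H →* Equiv.Perm X) : Representation ℂ H (X → ℂ) where
  toFun h := LinearMap.funLeft ℂ ℂ (τ h⁻¹)
  map_one' := by ext; simp
  map_mul' g h := by
    refine LinearMap.ext fun f => funext fun x => ?_
    simp [LinearMap.funLeft_apply]

theorem permRep_apply {H X : Type} [Group H] (τ : H →* Equiv.Perm X) (h : H) (f : X → ℂ) (x : X) :
    permRep τ h f x = f (τ h⁻¹ x) := rfl

theorem permRep_single {H X : Type} [Group H] [DecidableEq X] (τ : H →* Equiv.Perm X) (h : H)
    (y : X) : permRep τ h (Pi.single y 1) = Pi.single (τ h y) 1 := by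
  funext x
  simp only [permRep_apply, Pi.single_apply, map_inv, Equiv.Perm.inv_eq_iff_eq]

/-- A matrix commuting with all matrices invariant under a finite group of permutations is a
combination of the permutation matrices of the group. -/
theorem exists_eq_sum_perm {H X : Type} [Group H] [Fintype H] [Fintype X] [DecidableEq X]
    (τ : H →* Equiv.Perm X) (C : Matrix X X ℂ)
    (hC : ∀ N : Matrix X X ℂ, (∀ h x y, N (τ h x) (τ h y) = N x y) → C * N = N * C) :
    ∃ a : H → ℂ, ∀ x y, C x y = ∑ h, a h * if τ h y = x then 1 else 0 := by
  classical
  let ρ := permRep τ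
  -- Maschke's condition: it makes `W` semisimple, as Jacobson density requires.
  have : NeZero (Nat.card H : ℂ) := ⟨by simp⟩
  let W := ρ.asModule
  let c : W →+ W := (Matrix.toLin' C).toAddMonoidHom
  have hc : ∀ (f : Module.End (MonoidAlgebra ℂ H) W) (w : W), c (f w) = f (c w) := by
    intro f w
    let f' : (X → ℂ) →ₗ[ℂ] (X → ℂ) :=
      { toFun := fun v => f v
        map_add' := fun v w => f.map_add v w
        map_smul' := fun a v => by
          have := f.map_smul (algebraMap ℂ (MonoidAlgebra ℂ H) a) v
          have h2 : ∀ v : W, algebraMap ℂ (MonoidAlgebra ℂ H) a • v =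
              (a • (v : X → ℂ) : X → ℂ) := fun v => by
            have := (Representation.asAlgebraHom ρ).commutes a
            exact congrArg (fun F : (X → ℂ) →ₗ[ℂ] (X → ℂ) => F v) this
          exact (congrArg f (h2 v)).symm.trans (this.trans (h2 (f v))) }
    have hf : ∀ h v, f' (ρ h v) = ρ h (f' v) := by
      intro h v
      have h1 := f.map_smul (MonoidAlgebra.of ℂ H h) v
      have h2 : ∀ v : W, MonoidAlgebra.of ℂ H h • v = ρ h v := fun v => by
        have := Representation.asAlgebraHom_of ρ h
        exact congrArg (fun F : (X → ℂ) →ₗ[ℂ] (X → ℂ) => F v) this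
      exact (congrArg f (h2 v)).symm.trans (h1.trans (h2 (f v)))
    have hN := hC (LinearMap.toMatrix' f') (fun h x y => by
      rw [LinearMap.toMatrix'_apply, LinearMap.toMatrix'_apply]
      rw [← permRep_single, hf, permRep_apply]
      simp)
    have h4 := congrArg (fun A => Matrix.toLin' A (w : X → ℂ)) hN
    simp only [Matrix.toLin'_mul, Matrix.toLin'_toMatrix'] at h4
    exact h4
  -- `C` lies in the bicommutant, so on the finitely many basis vectors it agrees with some `r` in
  -- the group algebra; the coefficients of `r` are the required `a`.
  let F : Module.End (Module.End (MonoidAlgebra ℂ H) W) W :=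
    { c with map_smul' := fun f w => hc f w }
  obtain ⟨r, hr⟩ := jacobson_density F (Finset.univ.image fun y : X => (Pi.single y 1 : X → ℂ))
  refine ⟨fun h => r.coeff h, fun x y => ?_⟩
  have h1 := hr (Pi.single y 1 : X → ℂ) (Finset.mem_image_of_mem _ (Finset.mem_univ y))
  have h2 : (Matrix.toLin' C (Pi.single y 1) : X → ℂ) = ρ.asAlgebraHom r (Pi.single y 1) := h1
  have h3 := congrFun h2 x
  rw [Representation.asAlgebraHom_def, MonoidAlgebra.lift_apply, Finsupp.sum_fintype _ _ (by simp)]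
    at h3
  simp only [LinearMap.sum_apply, LinearMap.smul_apply, Finset.sum_apply, Pi.smul_apply] at h3
  rw [Matrix.toLin'_apply, Matrix.mulVec_single_one] at h3
  refine h3.trans (Finset.sum_congr rfl fun h _ => ?_)
  rw [permRep_single, Pi.single_apply, smul_eq_mul]
  simp only [eq_comm (a := x)]

/-! ### First fundamental theorem in matrix form -/

/-- Multi-indices: for each `i`, an `m`-tuple of elements of `{1, …, n_i}`. -/
abbrev Idx {r : ℕ} (n : Fin r → ℕ) (m : ℕ) : Type := (i : Fin r) → Fin m → Fin (n i)

/-- The matrix of `⨂_i g_i^{⊗ m}`. -/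
def Gam {r : ℕ} {n : Fin r → ℕ} (m : ℕ) (g : ∀ i, Matrix (Fin (n i)) (Fin (n i)) ℂ) :
    Matrix (Idx n m) (Idx n m) ℂ :=
  fun J K => ∏ i, ∏ k, g i (J i k) (K i k)

/-- The action of `S_m^r` on multi-indices. -/
def idxPerm {r : ℕ} (n : Fin r → ℕ) (m : ℕ) :
    (Fin r → Equiv.Perm (Fin m)) →* Equiv.Perm (Idx n m) where
  toFun s :=
    { toFun := fun J i k => J i ((s i)⁻¹ k)
      invFun := fun J i k => J i (s i k)
      left_inv := fun J => by simp
      right_inv := fun J => by simp }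
  map_one' := rfl
  map_mul' s t := by ext; simp

theorem idxPerm_apply {r : ℕ} {n : Fin r → ℕ} {m : ℕ} (s : Fin r → Equiv.Perm (Fin m))
    (J : Idx n m) (i : Fin r) (k : Fin m) : idxPerm n m s J i k = J i ((s i)⁻¹ k) := rfl

/-- The exponent vector of the monomial `∏ x^{(i)}_{J_i(k), K_i(k)}`. -/
def expo {r : ℕ} {n : Fin r → ℕ} {m : ℕ} (J K : Idx n m) :
    (Σ i, Fin (n i) × Fin (n i)) →₀ ℕ :=
  ∑ i, ∑ k, Finsupp.single ⟨i, J i k, K i k⟩ 1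

theorem expo_apply {r : ℕ} {n : Fin r → ℕ} {m : ℕ} (J K : Idx n m) (i : Fin r)
    (a : Fin (n i) × Fin (n i)) :
    expo J K ⟨i, a⟩ = Fintype.card {k // (J i k, K i k) = a} := by
  rw [expo, Finsupp.finsetSum_apply, Finset.sum_eq_single i]
  · simp [Finsupp.finsetSum_apply, Finsupp.single_apply, Fintype.card_subtype]
  · intro i' _ h
    rw [Finsupp.finsetSum_apply]
    refine Finset.sum_eq_zero fun k _ => ?_
    rw [Finsupp.single_apply, if_neg]
    exact fun h' => h (congrArg Sigma.fst h')
  · simp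

/-- The exponent vector counts how often each index pair occurs. Equal counts give bijections
between the fibres, which glue to one permutation for each `i`. -/
theorem exists_idxPerm_of_expo_eq {r : ℕ} {n : Fin r → ℕ} {m : ℕ} {J K J' K' : Idx n m}
    (h : expo J K = expo J' K') : ∃ s, idxPerm n m s J = J' ∧ idxPerm n m s K = K' := by
  have e : ∀ i a, {k // (J i k, K i k) = a} ≃ {k // (J' i k, K' i k) = a} := fun i a =>
    Fintype.equivOfCardEq (by rw [← expo_apply, ← expo_apply, h])
  have hs := fun i k => Equiv.ofFiberEquiv_map (e i) k
  refine ⟨fun i => Equiv.ofFiberEquiv (e i), ?_, ?_⟩ <;> funext i k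
  · have := congrArg Prod.fst (hs i ((Equiv.ofFiberEquiv (e i)).symm k))
    rw [Equiv.apply_symm_apply] at this
    exact this.symm
  · have := congrArg Prod.snd (hs i ((Equiv.ofFiberEquiv (e i)).symm k))
    rw [Equiv.apply_symm_apply] at this
    exact this.symm

open Classical in
/-- The functional sending the monomial with exponent `expo J K` to `N J K`. -/
def monoFunctional {r : ℕ} {n : Fin r → ℕ} {m : ℕ} (N : Matrix (Idx n m) (Idx n m) ℂ) :
    MvPolynomial (Σ i, Fin (n i) × Fin (n i)) ℂ →ₗ[ℂ] ℂ :=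
  (MvPolynomial.basisMonomials _ ℂ).constr ℂ fun e =>
    if h : ∃ P : Idx n m × Idx n m, expo P.1 P.2 = e then N h.choose.1 h.choose.2 else 0

/-- Pairs with the same monomial lie in one `S_m^r`-orbit, so invariance of `N` makes the chosen
representative irrelevant. -/
theorem monoFunctional_monomial {r : ℕ} {n : Fin r → ℕ} {m : ℕ} (N : Matrix (Idx n m) (Idx n m) ℂ)
    (hN : ∀ s J K, N (idxPerm n m s J) (idxPerm n m s K) = N J K) (J K : Idx n m) :
    monoFunctional N (MvPolynomial.monomial (expo J K) 1) = N J K := by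
  have h : ∃ P : Idx n m × Idx n m, expo P.1 P.2 = expo J K := ⟨(J, K), rfl⟩
  have h1 := (MvPolynomial.basisMonomials (Σ i, Fin (n i) × Fin (n i)) ℂ).constr_basis ℂ (fun e =>
    open Classical in
    if h : ∃ P : Idx n m × Idx n m, expo P.1 P.2 = e then N h.choose.1 h.choose.2 else 0)
    (expo J K)
  rw [MvPolynomial.coe_basisMonomials] at h1
  refine h1.trans ?_
  rw [dif_pos h]
  obtain ⟨s, h2, h3⟩ := exists_idxPerm_of_expo_eq h.choose_spec
  rw [← hN s, h2, h3]

/-- A polynomial in the entries of matrices `x^{(1)}, …, x^{(r)}` that vanishes on invertible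
matrices is zero. -/
theorem eq_zero_of_eval_GL {r : ℕ} {n : Fin r → ℕ}
    (p : MvPolynomial (Σ i, Fin (n i) × Fin (n i)) ℂ)
    (hp : ∀ g : G n, MvPolynomial.eval (fun x => (g x.1 : Matrix _ _ ℂ) x.2.1 x.2.2) p = 0) :
    p = 0 := by
  let A : ∀ i, Matrix (Fin (n i)) (Fin (n i)) (MvPolynomial (Σ i, Fin (n i) × Fin (n i)) ℂ) :=
    fun i => Matrix.of fun a b => MvPolynomial.X ⟨i, a, b⟩
  have hA : ∀ (x : (Σ i, Fin (n i) × Fin (n i)) → ℂ) i, MvPolynomial.eval x (A i).det =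
      (Matrix.of fun a b => x ⟨i, a, b⟩).det := fun x i => by
    rw [RingHom.map_det]
    congr 1
    ext a b
    simp [A]
  -- The product of the generic determinants is 1 at the identity matrices. Multiplying `p` by it
  -- yields a polynomial vanishing everywhere, and the polynomial ring is a domain.
  have hne : (∏ i, (A i).det) ≠ 0 := by
    intro h0
    have h1 := congrArg (MvPolynomial.eval fun x => if x.2.1 = x.2.2 then 1 else 0) h0
    rw [map_prod, map_zero] at h1
    simp only [hA] at h1
    have : ∀ i, (Matrix.of fun a b : Fin (n i) => if a = b then (1 : ℂ) else 0) = 1 := fun i => by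
      ext a b
      simp [Matrix.one_apply]
    simp [this] at h1
  refine (mul_eq_zero.mp ?_).resolve_right hne
  refine MvPolynomial.funext fun x => ?_
  rw [map_mul, map_prod, map_zero]
  simp only [hA]
  by_cases h : ∃ i, (Matrix.of fun a b => x ⟨i, a, b⟩).det = 0
  · obtain ⟨i, hi⟩ := h
    rw [Finset.prod_eq_zero (Finset.mem_univ i) hi, mul_zero]
  · push Not at h
    have := hp fun i => Matrix.GeneralLinearGroup.mkOfDetNeZero _ (h i)
    rw [show x = fun y => (Matrix.GeneralLinearGroup.mkOfDetNeZero _ (h y.1) :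
      Matrix (Fin (n y.1)) (Fin (n y.1)) ℂ) y.2.1 y.2.2 from rfl, this, zero_mul]

theorem prod_X_eq_monomial_expo {r : ℕ} {n : Fin r → ℕ} {m : ℕ} (J K : Idx n m) :
    ∏ i, ∏ k, (MvPolynomial.X ⟨i, J i k, K i k⟩ :
      MvPolynomial (Σ i, Fin (n i) × Fin (n i)) ℂ) = MvPolynomial.monomial (expo J K) 1 := by
  simp only [expo, MvPolynomial.monomial_sum_one, MvPolynomial.X]

/-- Commutation with `Gam m g` for all invertible `g` is a polynomial identity in the entries of
generic matrices. Applying the linear functional that replaces each monomial by the corresponding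
entry of `N` turns it into commutation with `N`. -/
theorem commute_of_commute_Gam {r : ℕ} {n : Fin r → ℕ} {m : ℕ} {C : Matrix (Idx n m) (Idx n m) ℂ}
    (hC : ∀ g : G n, C * Gam m (fun i => (g i : Matrix _ _ ℂ)) =
      Gam m (fun i => (g i : Matrix _ _ ℂ)) * C)
    (N : Matrix (Idx n m) (Idx n m) ℂ)
    (hN : ∀ s J K, N (idxPerm n m s J) (idxPerm n m s K) = N J K) : C * N = N * C := by
  ext J K
  let mo : Idx n m → Idx n m → MvPolynomial (Σ i, Fin (n i) × Fin (n i)) ℂ :=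
    fun J K => MvPolynomial.monomial (expo J K) 1
  have h0 : ∑ L, C J L • mo L K - ∑ L, C L K • mo J L = 0 := by
    refine eq_zero_of_eval_GL _ fun g => ?_
    have hmo : ∀ J K, MvPolynomial.eval (fun x => (g x.1 : Matrix _ _ ℂ) x.2.1 x.2.2) (mo J K) =
        Gam m (fun i => (g i : Matrix _ _ ℂ)) J K := fun J K => by
      simp only [mo, ← prod_X_eq_monomial_expo, map_prod, MvPolynomial.eval_X, Gam]
    have := congrFun (congrFun (hC g) J) K
    rw [Matrix.mul_apply, Matrix.mul_apply] at this
    simp only [map_sub, map_sum, MvPolynomial.smul_eval, hmo]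
    rw [this, sub_eq_zero]
    exact Finset.sum_congr rfl fun L _ => mul_comm _ _
  have h1 := congrArg (monoFunctional N) h0
  simp only [map_sub, map_sum, map_smul, map_zero, mo, monoFunctional_monomial N hN,
    smul_eq_mul] at h1
  rw [Matrix.mul_apply, Matrix.mul_apply, sub_eq_zero.mp h1]
  exact Finset.sum_congr rfl fun L _ => mul_comm _ _

theorem Gam_mul {r : ℕ} {n : Fin r → ℕ} {m : ℕ} (g h : ∀ i, Matrix (Fin (n i)) (Fin (n i)) ℂ) :
    Gam m g * Gam m h = Gam m fun i => g i * h i := by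
  ext J K
  simp only [Matrix.mul_apply, Gam, ← Finset.prod_mul_distrib]
  rw [← Fintype.piFinset_univ, ← Finset.prod_univ_sum (t := fun i => Finset.univ)
    (f := fun i (L : Fin m → Fin (n i)) => ∏ k, g i (J i k) (L k) * h i (L k) (K i k))]
  refine Finset.prod_congr rfl fun i _ => ?_
  rw [← Fintype.piFinset_univ, ← Finset.prod_univ_sum (t := fun k => Finset.univ)
    (f := fun k (l : Fin (n i)) => g i (J i k) l * h i l (K i k))]

theorem Gam_one {r : ℕ} {n : Fin r → ℕ} {m : ℕ} :
    Gam m (fun i => (1 : Matrix (Fin (n i)) (Fin (n i)) ℂ)) = 1 := by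
  ext J K
  simp only [Gam, Matrix.one_apply, Fintype.prod_ite_zero, Finset.prod_const_one]
  exact if_congr (by simp [funext_iff]) rfl rfl

/-- The matrix of the permutation `s ∈ S_m^r` of the tensor factors. -/
def permMat {r : ℕ} (n : Fin r → ℕ) {m : ℕ} (s : Fin r → Equiv.Perm (Fin m)) :
    Matrix (Idx n m) (Idx n m) ℂ :=
  fun J K => if ∀ i k, K i k = J i (s i k) then 1 else 0

theorem permMat_eq {r : ℕ} (n : Fin r → ℕ) {m : ℕ} (s : Fin r → Equiv.Perm (Fin m))
    (J K : Idx n m) : permMat n s J K = if idxPerm n m s K = J then 1 else 0 := by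
  refine if_congr ⟨fun h => ?_, ?_⟩ rfl rfl
  · funext i k
    rw [idxPerm_apply, h]
    simp
  · rintro rfl i k
    simp [idxPerm_apply]

theorem permMat_commute_Gam {r : ℕ} {n : Fin r → ℕ} {m : ℕ} (s : Fin r → Equiv.Perm (Fin m))
    (g : ∀ i, Matrix (Fin (n i)) (Fin (n i)) ℂ) :
    permMat n s * Gam m g = Gam m g * permMat n s := by
  ext J K
  have h : ∀ L, (idxPerm n m s L = J ↔ (idxPerm n m s).symm J = L) := fun L => by
    rw [Equiv.symm_apply_eq, eq_comm]
  simp only [Matrix.mul_apply, permMat_eq, h, ite_mul, one_mul, zero_mul, mul_ite, mul_one,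
    mul_zero, Finset.sum_ite_eq, Finset.mem_univ, if_true]
  refine Finset.prod_congr rfl fun i _ => ?_
  refine Fintype.prod_equiv (s i) _ _ fun k => ?_
  simp [idxPerm_apply]
  rfl

/-- First fundamental theorem for `GL(n_1) × ⋯ × GL(n_r)`, in matrix form. -/
theorem exists_eq_sum_permMat {r : ℕ} {n : Fin r → ℕ} {m : ℕ} {C : Matrix (Idx n m) (Idx n m) ℂ}
    (hC : ∀ g : G n, C * Gam m (fun i => (g i : Matrix _ _ ℂ)) =
      Gam m (fun i => (g i : Matrix _ _ ℂ)) * C) :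
    ∃ a : (Fin r → Equiv.Perm (Fin m)) → ℂ, ∀ J K, C J K = ∑ s, a s * permMat n s J K := by
  obtain ⟨a, ha⟩ := exists_eq_sum_perm (idxPerm n m) C (commute_of_commute_Gam hC)
  exact ⟨a, fun J K => by simp only [ha, permMat_eq]⟩

/-! ### Standard bases and the action in coordinates -/

/-- The standard basis of `V(n)`. -/
def basisV {r : ℕ} (n : Fin r → ℕ) : Basis (∀ i, Fin (n i)) ℂ (V n) :=
  Basis.piTensorProduct fun i => Pi.basisFun ℂ (Fin (n i))

/-- The standard basis of `V(n) ⊕ V(n)^*`. -/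
def basisVD {r : ℕ} (n : Fin r → ℕ) :
    Basis (Bool × ∀ i, Fin (n i)) ℂ (V n × Dual ℂ (V n)) :=
  ((basisV n).prod (basisV n).dualBasis).reindex (Equiv.boolProdEquivSum _).symm

/-- Indices of the standard basis of `⊗^d (V(n) ⊕ V(n)^*)`. -/
abbrev TIdx {r : ℕ} (n : Fin r → ℕ) (d : ℕ) : Type :=
  (Fin d → Bool) × ∀ i : Fin r, Fin d → Fin (n i)

/-- The standard basis of `⊗^d (V(n) ⊕ V(n)^*)`. -/
def basisT {r : ℕ} (n : Fin r → ℕ) (d : ℕ) : Basis (TIdx n d) ℂ (T n d) :=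
  (Basis.piTensorProduct fun _ : Fin d => basisVD n).reindex
    ((Equiv.arrowProdEquivProdArrow _ _ _).trans ((Equiv.refl _).prodCongr (Equiv.piComm _)))

theorem basisVD_false {r : ℕ} (n : Fin r → ℕ) (I : ∀ i, Fin (n i)) :
    basisVD n (false, I) = (basisV n I, 0) := by
  simp [basisVD, Basis.prod_apply]

theorem basisVD_true {r : ℕ} (n : Fin r → ℕ) (I : ∀ i, Fin (n i)) :
    basisVD n (true, I) = (0, (basisV n).dualBasis I) := by
  simp [basisVD, Basis.prod_apply]

theorem basisVD_repr_false {r : ℕ} (n : Fin r → ℕ) (I : ∀ i, Fin (n i))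
    (x : V n × Dual ℂ (V n)) : (basisVD n).repr x (false, I) = (basisV n).repr x.1 I := by
  simp [basisVD]

theorem basisVD_repr_true {r : ℕ} (n : Fin r → ℕ) (I : ∀ i, Fin (n i))
    (x : V n × Dual ℂ (V n)) : (basisVD n).repr x (true, I) = x.2 (basisV n I) := by
  simp [basisVD]

theorem basisT_apply {r : ℕ} (n : Fin r → ℕ) (d : ℕ) (b : Fin d → Bool)
    (p : ∀ i, Fin d → Fin (n i)) :
    basisT n d (b, p) = ⨂ₜ[ℂ] j, basisVD n (b j, fun i => p i j) := by
  simp [basisT]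
  rfl

theorem basisT_repr_tprod {r : ℕ} (n : Fin r → ℕ) (d : ℕ) (x : Fin d → V n × Dual ℂ (V n))
    (b : Fin d → Bool) (p : ∀ i, Fin d → Fin (n i)) :
    (basisT n d).repr (⨂ₜ[ℂ] j, x j) (b, p) =
      ∏ j, (basisVD n).repr (x j) (b j, fun i => p i j) := by
  rw [basisT, Basis.repr_reindex_apply]
  exact Basis.piTensorProduct_repr_tprod_apply _ _ _

/-- The matrix of `g` on `ℂ^n`, or on the dual space. -/
def twMat {n : ℕ} (g : GL (Fin n) ℂ) : Bool → Matrix (Fin n) (Fin n) ℂ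
  | false => g
  | true => ((g⁻¹ : GL (Fin n) ℂ) : Matrix (Fin n) (Fin n) ℂ).transpose

theorem repV_basisV_repr {r : ℕ} (n : Fin r → ℕ) (g : G n) (I I' : ∀ i, Fin (n i)) :
    (basisV n).repr (repV n g (basisV n I)) I' =
      ∏ i, (g i : Matrix (Fin (n i)) (Fin (n i)) ℂ) (I' i) (I i) := by
  rw [basisV, Basis.piTensorProduct_apply]
  change (Basis.piTensorProduct _).repr (PiTensorProduct.map _ _) I' = _
  rw [PiTensorProduct.map_tprod, Basis.piTensorProduct_repr_tprod_apply]
  refine Finset.prod_congr rfl fun i _ => ?_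
  change (Matrix.toLin' (g i : Matrix (Fin (n i)) (Fin (n i)) ℂ) _) _ = _
  simp

theorem rep_basisVD_repr {r : ℕ} (n : Fin r → ℕ) (g : G n) (c c' : Bool) (I I' : ∀ i, Fin (n i)) :
    (basisVD n).repr (((repV n).prod (repV n).dual) g (basisVD n (c, I))) (c', I') =
      if c = c' then ∏ i, twMat (g i) c (I' i) (I i) else 0 := by
  cases c <;> cases c'
  · rw [basisVD_repr_false, basisVD_false]
    exact repV_basisV_repr n g I I'
  · rw [basisVD_repr_true, basisVD_false]
    simp
  · rw [basisVD_repr_false, basisVD_true]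
    simp
  · rw [basisVD_repr_true, basisVD_true]
    simp only [Representation.prod_apply_apply, Representation.dual_apply, Module.Dual.transpose_apply,
      Basis.dualBasis_apply, LinearMap.comp_apply, if_true, twMat, Matrix.transpose_apply]
    exact repV_basisV_repr n g⁻¹ I' I

theorem repT_basisT_repr {r : ℕ} (n : Fin r → ℕ) (d : ℕ) (g : G n) (b b' : Fin d → Bool)
    (p p' : ∀ i, Fin d → Fin (n i)) :
    (basisT n d).repr (repT n d g (basisT n d (b, p))) (b', p') =
      if b = b' then ∏ i, ∏ j, twMat (g i) (b j) (p' i j) (p i j) else 0 := by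
  rw [basisT_apply]
  change (basisT n d).repr (PiTensorProduct.map _ _) _ = _
  rw [PiTensorProduct.map_tprod, basisT_repr_tprod]
  simp only [rep_basisVD_repr]
  by_cases h : b = b'
  · subst h
    simp only [if_true]
    exact Finset.prod_comm
  · obtain ⟨j, hj⟩ := Function.ne_iff.mp h
    rw [if_neg h, Finset.prod_eq_zero (Finset.mem_univ j) (if_neg hj)]

theorem repT_repr {r : ℕ} (n : Fin r → ℕ) (d : ℕ) (g : G n) (x : T n d) (b : Fin d → Bool)
    (q : ∀ i, Fin d → Fin (n i)) :
    (basisT n d).repr (repT n d g x) (b, q) =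
      ∑ p, (∏ i, ∏ j, twMat (g i) (b j) (q i j) (p i j)) * (basisT n d).repr x (b, p) := by
  conv_lhs => rw [← (basisT n d).sum_repr x]
  simp only [map_sum, map_smul, Finsupp.finsetSum_apply, Finsupp.smul_apply, smul_eq_mul]
  rw [Fintype.sum_prod_type, Finset.sum_eq_single b]
  · exact Finset.sum_congr rfl fun p _ => by rw [repT_basisT_repr, if_pos rfl, mul_comm]
  · intro b' _ h
    exact Finset.sum_eq_zero fun p _ => by rw [repT_basisT_repr, if_neg h, mul_zero]
  · simp

theorem twIncl_twSplit_symm {r : ℕ} (n : Fin r → ℕ) (c : Bool) (I : ∀ i, Fin (n i)) :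
    twIncl (V n) c ((twSplit n c).symm (⨂ₜ[ℂ] i, twBasis (n i) c (I i))) = basisVD n (c, I) := by
  cases c
  · rw [basisVD_false, basisV, Basis.piTensorProduct_apply]
    rfl
  · rw [basisVD_true]
    change (0, PiTensorProduct.dualDistrib (⨂ₜ[ℂ] i, (Pi.basisFun ℂ (Fin (n i))).dualBasis (I i)))
      = (0, _)
    congr 1
    refine (basisV n).ext fun K => ?_
    rw [basisV, Basis.dualBasis_apply, Basis.piTensorProduct_apply,
      PiTensorProduct.dualDistrib_apply, Basis.piTensorProduct_repr_tprod_apply]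
    simp only [Basis.dualBasis_apply]

theorem inclT_Phi_symm {r : ℕ} (n : Fin r → ℕ) {d : ℕ} (b : Fin d → Bool)
    (p : ∀ i, Fin d → Fin (n i)) :
    inclT n b ((Phi n b).symm (⨂ₜ[ℂ] i, ⨂ₜ[ℂ] j, twBasis (n i) (b j) (p i j))) =
      basisT n d (b, p) := by
  rw [← Phi_tprod n b fun j i => twBasis (n i) (b j) (p i j), LinearEquiv.symm_apply_apply,
    inclT, PiTensorProduct.map_tprod, basisT_apply]
  simp only [twIncl_twSplit_symm]

/-! ### Coefficient matrices of the tensors `phi` -/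

/-- The positions `1, …, m` and `m + 1, …, 2m`. -/
def posEquiv (m : ℕ) : Fin m ⊕ Fin m ≃ Fin (2 * m) :=
  finSumFinEquiv.trans (finCongr (two_mul m).symm)

theorem b₀_inl {m : ℕ} (k : Fin m) : b₀ m (posEquiv m (.inl k)) = false := by
  simp [b₀, posEquiv]

theorem b₀_inr {m : ℕ} (k : Fin m) : b₀ m (posEquiv m (.inr k)) = true := by
  simp [b₀, posEquiv]

/-- The positions of a multi-index on `2m` places, as permuted by `γ`, split into two halves. -/
def splitIdx {r : ℕ} (n : Fin r → ℕ) {m : ℕ} (γ : Equiv.Perm (Fin (2 * m))) :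
    (∀ i : Fin r, Fin (2 * m) → Fin (n i)) ≃ Idx n m × Idx n m where
  toFun p := (fun i k => p i (γ (posEquiv m (.inl k))), fun i k => p i (γ (posEquiv m (.inr k))))
  invFun P i k := Sum.elim (P.1 i) (P.2 i) ((posEquiv m).symm (γ.symm k))
  left_inv p := by
    funext i k
    obtain ⟨k, rfl⟩ := γ.surjective k
    obtain ⟨k, rfl⟩ := (posEquiv m).surjective k
    cases k <;> simp
  right_inv P := by simp

theorem twCast_twBasis (n : ℕ) {b b' : Bool} (h : b = b') (a : Fin n) :
    twCast (Fin n → ℂ) h (twBasis n b a) = twBasis n b' a := by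
  subst h
  rfl

theorem Psi_t {n m : ℕ} {M : Sub m} (γ : Shuffle M) (σ : Equiv.Perm (Fin m)) :
    Psi n γ (t n σ) = ∑ J : Fin m → Fin n, ⨂ₜ[ℂ] k, twBasis n (bM M k)
      (Sum.elim J (J ∘ σ) ((posEquiv m).symm (γ.1.symm k))) := by
  have h : ∀ (J : Fin m → Fin n) (k : Fin (2 * m)),
      (if h : (k : ℕ) < m then J ⟨k, h⟩ else J (σ ⟨(k : ℕ) - m, by have := k.2; omega⟩)) =
        Sum.elim J (J ∘ σ) ((posEquiv m).symm k) := by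
    intro J k
    obtain ⟨k, rfl⟩ := (posEquiv m).surjective k
    rw [Equiv.symm_apply_apply]
    cases k <;> simp [posEquiv]
  rw [t, map_sum]
  refine Finset.sum_congr rfl fun J _ => ?_
  simp only [h]
  rw [Psi, LinearEquiv.trans_apply, PiTensorProduct.reindex_tprod, PiTensorProduct.congr_tprod]
  simp only [twCast_twBasis]

theorem phi_eq_sum {r : ℕ} (n : Fin r → ℕ) {m : ℕ} {M : Sub m} (γ : Shuffle M)
    (s : Fin r → Equiv.Perm (Fin m)) :
    phi n γ s = ∑ J : Idx n m, basisT n (2 * m)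
      (bM M, (splitIdx n γ.1).symm (J, fun i k => J i (s i k))) := by
  classical
  rw [phi, tM]
  simp only [Psi_t]
  rw [MultilinearMap.map_sum, map_sum, map_sum]
  refine Finset.sum_congr rfl fun J _ => ?_
  rw [← inclT_Phi_symm]
  rfl

/-- Each summand of `phi_eq_sum` is a basis vector determined by its first half `J`, so at most one
summand contributes. Read through `γ`, the coefficients no longer depend on `γ`. -/
theorem phi_repr {r : ℕ} (n : Fin r → ℕ) {m : ℕ} {M : Sub m} (γ : Shuffle M)
    (s : Fin r → Equiv.Perm (Fin m)) (b : Fin (2 * m) → Bool)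
    (p : ∀ i, Fin (2 * m) → Fin (n i)) :
    (basisT n (2 * m)).repr (phi n γ s) (b, p) = if bM M = b then
      permMat n s (splitIdx n γ.1 p).1 (splitIdx n γ.1 p).2 else 0 := by
  obtain ⟨⟨J, K⟩, rfl⟩ := (splitIdx n γ.1).symm.surjective p
  rw [phi_eq_sum, map_sum, Finsupp.finsetSum_apply, Equiv.apply_symm_apply]
  simp only [Basis.repr_self, Finsupp.single_apply, Prod.mk.injEq, EmbeddingLike.apply_eq_iff_eq]
  by_cases hb : bM M = b
  · simp only [hb, true_and, if_true, permMat]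
    rw [Finset.sum_eq_single J]
    · exact if_congr (by simp [funext_iff, eq_comm]) rfl rfl
    · intro L _ h
      rw [if_neg fun h' => h h'.1]
    · simp
  · simp [hb]

theorem bM_injective {m : ℕ} : Function.Injective (bM (m := m)) := by
  intro M M' h
  refine Subtype.ext (Finset.ext fun k => ?_)
  simpa [bM] using congrFun h k

theorem exists_bM_eq {m : ℕ} (b : Fin (2 * m) → Bool)
    (hb : (Finset.univ.filter fun k => b k = true).card = m) : ∃ M : Sub m, bM M = b :=
  ⟨⟨_, hb⟩, by funext k; simp [bM]⟩

/-- The coefficients of a tensor at the basis vectors of type `b_M`, as a matrix. -/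
def coeffMat {r : ℕ} (n : Fin r → ℕ) {m : ℕ} {M : Sub m} (γ : Shuffle M) :
    T n (2 * m) →ₗ[ℂ] Matrix (Idx n m) (Idx n m) ℂ where
  toFun x J K := (basisT n (2 * m)).repr x (bM M, (splitIdx n γ.1).symm (J, K))
  map_add' x y := by ext; simp; rfl
  map_smul' a x := by ext; simp; rfl

theorem coeffMat_apply {r : ℕ} (n : Fin r → ℕ) {m : ℕ} {M : Sub m} (γ : Shuffle M)
    (x : T n (2 * m)) (J K : Idx n m) : coeffMat n γ x J K =
      (basisT n (2 * m)).repr x (bM M, (splitIdx n γ.1).symm (J, K)) := rfl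

theorem coeffMat_phi {r : ℕ} (n : Fin r → ℕ) {m : ℕ} (γ : (M : Sub m) → Shuffle M) (M M' : Sub m)
    (s : Fin r → Equiv.Perm (Fin m)) :
    coeffMat n (γ M') (phi n (γ M) s) = if M = M' then permMat n s else 0 := by
  ext J K
  rw [coeffMat_apply, phi_repr]
  by_cases h : M = M'
  · subst h
    simp
  · rw [if_neg h, if_neg (bM_injective.ne h)]
    rfl

theorem coeffMat_sum_phi {r : ℕ} (n : Fin r → ℕ) {m : ℕ} (γ : (M : Sub m) → Shuffle M) (M : Sub m)
    (c : Sub m × (Fin r → Equiv.Perm (Fin m)) → ℂ) (J K : Idx n m) :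
    coeffMat n (γ M) (∑ y, c y • phi n (γ y.1) y.2) J K = ∑ s, c (M, s) * permMat n s J K := by
  simp only [map_sum, map_smul, coeffMat_phi, Fintype.sum_prod_type]
  rw [Finset.sum_eq_single M (fun M' _ h => by simp [h]) (by simp)]
  simp [Matrix.sum_apply]

/-! ### Balanced tensors and the spanning statement -/

/-- Tensors whose components of all types other than the `b_M` vanish. -/
def IsBalanced {r : ℕ} {n : Fin r → ℕ} {m : ℕ} (x : T n (2 * m)) : Prop :=
  ∀ b q, (∀ M : Sub m, bM M ≠ b) → (basisT n (2 * m)).repr x (b, q) = 0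

theorem IsBalanced.ext {r : ℕ} {n : Fin r → ℕ} {m : ℕ} {x y : T n (2 * m)} (hx : IsBalanced x)
    (hy : IsBalanced y) (γ : (M : Sub m) → Shuffle M)
    (h : ∀ M, coeffMat n (γ M) x = coeffMat n (γ M) y) : x = y := by
  refine (basisT n (2 * m)).ext_elem fun ⟨b, q⟩ => ?_
  by_cases hb : ∃ M : Sub m, bM M = b
  · obtain ⟨M, rfl⟩ := hb
    obtain ⟨⟨J, K⟩, rfl⟩ := (splitIdx n (γ M).1).symm.surjective q
    exact congrFun (congrFun (h M) J) K
  · push Not at hb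
    rw [hx b q hb, hy b q hb]

theorem isBalanced_phi {r : ℕ} (n : Fin r → ℕ) {m : ℕ} {M : Sub m} (γ : Shuffle M)
    (s : Fin r → Equiv.Perm (Fin m)) : IsBalanced (phi n γ s) := by
  intro b q hb
  rw [phi_repr, if_neg (hb M)]

theorem IsBalanced.repT {r : ℕ} {n : Fin r → ℕ} {m : ℕ} {x : T n (2 * m)} (hx : IsBalanced x)
    (g : G n) : IsBalanced (repT n (2 * m) g x) := by
  intro b q hb
  rw [repT_repr]
  exact Finset.sum_eq_zero fun p _ => by rw [hx b p hb, mul_zero]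

/-- The dual positions carry the inverse transpose, hence the swapped order `P.2 Q.2`; this is what
makes the action on coefficient matrices a conjugation. -/
theorem prod_twMat {r : ℕ} (n : Fin r → ℕ) {m : ℕ} {M : Sub m} (γ : Shuffle M) (g : G n)
    (P Q : Idx n m × Idx n m) :
    ∏ i, ∏ j, twMat (g i) (bM M j) ((splitIdx n γ.1).symm Q i j) ((splitIdx n γ.1).symm P i j) =
      Gam m (fun i => (g i : Matrix (Fin (n i)) (Fin (n i)) ℂ)) Q.1 P.1 *
        Gam m (fun i => ((g⁻¹ : G n) i : Matrix (Fin (n i)) (Fin (n i)) ℂ)) P.2 Q.2 := by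
  rw [Gam, Gam, ← Finset.prod_mul_distrib]
  refine Finset.prod_congr rfl fun i _ => ?_
  rw [← Equiv.prod_comp ((posEquiv m).trans γ.1), Fintype.prod_sum_type]
  simp only [Equiv.trans_apply, γ.2, b₀_inl, b₀_inr, splitIdx, Equiv.coe_fn_symm_mk,
    Equiv.symm_apply_apply, Sum.elim_inl, Sum.elim_inr]
  rfl

theorem coeffMat_repT {r : ℕ} (n : Fin r → ℕ) {m : ℕ} {M : Sub m} (γ : Shuffle M) (g : G n)
    (x : T n (2 * m)) : coeffMat n γ (repT n (2 * m) g x) =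
      Gam m (fun i => (g i : Matrix (Fin (n i)) (Fin (n i)) ℂ)) * coeffMat n γ x *
        Gam m (fun i => ((g⁻¹ : G n) i : Matrix (Fin (n i)) (Fin (n i)) ℂ)) := by
  ext J K
  rw [coeffMat_apply, repT_repr, ← Equiv.sum_comp (splitIdx n γ.1).symm, Fintype.sum_prod_type_right]
  simp only [prod_twMat, Matrix.mul_apply, Finset.sum_mul, coeffMat_apply]
  exact Finset.sum_congr rfl fun K' _ => Finset.sum_congr rfl fun J' _ => by ring

theorem Gam_mul_Gam_inv {r : ℕ} {n : Fin r → ℕ} (m : ℕ) (g : G n) :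
    Gam m (fun i => (g i : Matrix (Fin (n i)) (Fin (n i)) ℂ)) *
      Gam m (fun i => ((g⁻¹ : G n) i : Matrix (Fin (n i)) (Fin (n i)) ℂ)) = 1 := by
  rw [Gam_mul, ← Gam_one]
  congr 1
  funext i
  exact (g i).mul_inv

theorem phi_mem_invT {r : ℕ} (n : Fin r → ℕ) {m : ℕ} (γ : (M : Sub m) → Shuffle M) (M : Sub m)
    (s : Fin r → Equiv.Perm (Fin m)) : phi n (γ M) s ∈ invT n (2 * m) := by
  rw [mem_invT]
  intro g
  refine ((isBalanced_phi n (γ M) s).repT g).ext (isBalanced_phi n (γ M) s) γ fun M' => ?_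
  rw [coeffMat_repT, coeffMat_phi]
  split_ifs
  · rw [← permMat_commute_Gam, Matrix.mul_assoc, Gam_mul_Gam_inv, Matrix.mul_one]
  · simp

/-- The scalar matrix `2`. -/
def twoGL (n : ℕ) : GL (Fin n) ℂ :=
  Units.map (Matrix.scalar (Fin n)).toMonoidHom (Units.mk0 2 two_ne_zero)

theorem twMat_twoGL (n : ℕ) (c : Bool) :
    twMat (twoGL n) c = Matrix.diagonal fun _ => (2 : ℂ) ^ (if c then -1 else 1 : ℤ) := by
  cases c
  · simp only [twMat, twoGL]
    ext a b
    simp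
  · have : ((twoGL n)⁻¹ : GL (Fin n) ℂ) =
        Units.map (Matrix.scalar (Fin n)).toMonoidHom (Units.mk0 2 two_ne_zero)⁻¹ := by
      rw [twoGL, map_inv]
    simp only [twMat, this]
    ext a b
    simp [Matrix.diagonal_apply, eq_comm]

/-- With the scalar 2 in every factor, a component with `u` dual positions is multiplied by `2 ^ (r
* (2m - 2u))`. For a nonzero invariant component this is 1, and `r ≥ 1` gives `u = m`. -/
theorem isBalanced_of_mem_invT {r : ℕ} (hr : 1 ≤ r) {n : Fin r → ℕ} {m : ℕ} {x : T n (2 * m)}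
    (hx : x ∈ invT n (2 * m)) : IsBalanced x := by
  intro b q hb
  by_contra hne
  have h := repT_repr n (2 * m) (fun i => twoGL (n i)) x b q
  rw [(mem_invT n _ x).mp hx] at h
  have hp : ∀ p, p ≠ q → ∏ i, ∏ j, twMat (twoGL (n i)) (b j) (q i j) (p i j) = 0 := by
    intro p hpq
    obtain ⟨i, hi⟩ := Function.ne_iff.mp hpq
    obtain ⟨j, hj⟩ := Function.ne_iff.mp hi
    refine Finset.prod_eq_zero (Finset.mem_univ i) (Finset.prod_eq_zero (Finset.mem_univ j) ?_)
    rw [twMat_twoGL, Matrix.diagonal_apply_ne' _ hj]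
  rw [Finset.sum_eq_single q (fun p _ hpq => by rw [hp p hpq, zero_mul]) (by simp)] at h
  have h1 := mul_eq_right₀ hne |>.mp h.symm
  simp only [twMat_twoGL, Matrix.diagonal_apply_eq, Finset.prod_const, Finset.card_univ,
    Fintype.card_fin] at h1
  have h2 : ∏ j, (2 : ℂ) ^ (if b j then -1 else 1 : ℤ) =
      2 ^ ((2 * m : ℤ) - 2 * (Finset.univ.filter fun k => b k = true).card) := by
    have hcard := Finset.card_filter_add_card_filter_not (s := Finset.univ) (fun k => b k = true)
    rw [Finset.card_univ, Fintype.card_fin] at hcard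
    simp only [apply_ite (fun z : ℤ => (2 : ℂ) ^ z), Finset.prod_ite, Finset.prod_const]
    rw [← zpow_natCast, ← zpow_mul, ← zpow_natCast, ← zpow_mul, ← zpow_add₀ two_ne_zero]
    congr 1
    omega
  rw [h2, ← zpow_natCast, ← zpow_mul] at h1
  -- Norms move the equation to the ordered field of reals, where a power of 2 equals 1 only for
  -- exponent 0.
  have h3 := congrArg norm h1
  rw [norm_zpow, norm_one, Complex.norm_ofNat,
    zpow_eq_one_iff_right₀ (by norm_num) (by norm_num)] at h3
  have h4 : (Finset.univ.filter fun k => b k = true).card = m := by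
    rcases mul_eq_zero.mp h3 with h | h <;> omega
  obtain ⟨M, hM⟩ := exists_bM_eq b h4
  exact hb M hM

theorem span_phi_eq_invT {r : ℕ} (hr : 1 ≤ r) (n : Fin r → ℕ) {m : ℕ}
    (γ : (M : Sub m) → Shuffle M) :
    Submodule.span ℂ (Set.range fun x : Sub m × (Fin r → Equiv.Perm (Fin m)) =>
      phi n (γ x.1) x.2) = invT n (2 * m) := by
  refine le_antisymm (Submodule.span_le.mpr ?_) fun x hx => ?_
  · rintro _ ⟨⟨M, s⟩, rfl⟩
    exact phi_mem_invT n γ M s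
  · have hC : ∀ M, ∃ a : (Fin r → Equiv.Perm (Fin m)) → ℂ, ∀ J K,
        coeffMat n (γ M) x J K = ∑ s, a s * permMat n s J K := fun M => by
      refine exists_eq_sum_permMat fun g => ?_
      have h1 := coeffMat_repT n (γ M) g x
      rw [(mem_invT n _ x).mp hx] at h1
      -- Used at `g⁻¹` to cancel on the right, turning invariance under conjugation into
      -- commutation.
      have h2 := Gam_mul_Gam_inv m g⁻¹
      rw [inv_inv] at h2
      conv_lhs => rw [h1, Matrix.mul_assoc]
      erw [h2]
      rw [Matrix.mul_one]
    choose a ha using hC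
    have hsum : x = ∑ y : Sub m × (Fin r → Equiv.Perm (Fin m)), a y.1 y.2 • phi n (γ y.1) y.2 := by
      refine (isBalanced_of_mem_invT hr hx).ext ?_ γ fun M => ?_
      · intro b q hb
        simp only [map_sum, map_smul, Finsupp.finsetSum_apply, Finsupp.smul_apply]
        exact Finset.sum_eq_zero fun y _ => by rw [isBalanced_phi n (γ y.1) y.2 b q hb, smul_zero]
      · ext J K
        rw [ha, coeffMat_sum_phi n γ M fun y => a y.1 y.2]
    rw [hsum]
    exact Submodule.sum_mem _ fun y _ =>
      Submodule.smul_mem _ _ (Submodule.subset_span ⟨y, rfl⟩)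

/-! ### Linear independence and its failure -/

theorem linearIndependent_phi {r : ℕ} (n : Fin r → ℕ) {m : ℕ} (γ : (M : Sub m) → Shuffle M)
    (hm : ∀ i, m ≤ n i) :
    LinearIndependent ℂ fun x : Sub m × (Fin r → Equiv.Perm (Fin m)) => phi n (γ x.1) x.2 := by
  refine Fintype.linearIndependent_iffₛ.mpr ?_
  rintro c c' hc ⟨M, s⟩
  -- All entries of each `J i` are distinct, so among the permutation matrices only that of `s` is
  -- nonzero at the entry `(J, J ∘ s)`; this isolates the coefficient at `(M, s)`.
  let J : Idx n m := fun i => Fin.castLE (hm i)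
  have h := congrFun (congrFun (congrArg (coeffMat n (γ M)) hc) J) fun i k => J i (s i k)
  rw [coeffMat_sum_phi, coeffMat_sum_phi] at h
  have hs : ∀ s', permMat n s' J (fun i k => J i (s i k)) = if s' = s then 1 else 0 := fun s' => by
    refine if_congr ⟨fun h => ?_, ?_⟩ rfl rfl
    · funext i
      ext1 k
      exact (Fin.castLE_injective (hm i) (h i k)).symm
    · rintro rfl i k
      rfl
  simpa [hs] using h

/-- When `J` and `K` agree away from `i`, the entry is the determinant of the 0-1 matrix recording
`K i b = J i a`. By pigeonhole `J i` repeats a value, so two rows coincide. Otherwise every term is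
zero. -/
theorem sum_sign_permMat {r : ℕ} {n : Fin r → ℕ} {m : ℕ} (i : Fin r) (hi : n i < m) :
    ∑ σ : Equiv.Perm (Fin m), ((Equiv.Perm.sign σ : ℤ) : ℂ) •
      permMat n (Function.update 1 i σ) = 0 := by
  ext J K
  rw [Matrix.sum_apply]
  simp only [Matrix.smul_apply, Matrix.zero_apply]
  by_cases h : ∀ i', i' ≠ i → K i' = J i'
  · have h1 : ∀ σ, permMat n (Function.update 1 i σ) J K =
        ∏ k, (Matrix.of fun a b => if K i b = J i a then (1 : ℂ) else 0) (σ k) k := fun σ => by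
      simp only [Matrix.of_apply, Fintype.prod_ite_zero, Finset.prod_const_one]
      refine if_congr ⟨fun h' k => ?_, fun h' i' k => ?_⟩ rfl rfl
      · simpa using h' i k
      · by_cases hi' : i' = i
        · subst hi'
          simpa using h' k
        · simp [hi', h i' hi']
    simp only [h1, smul_eq_mul]
    rw [← Matrix.det_apply']
    obtain ⟨k, l, hkl, hJ⟩ := Fintype.exists_ne_map_eq_of_card_lt (J i) (by simpa using hi)
    exact Matrix.det_zero_of_row_eq hkl (by funext b; simp [hJ])
  · refine Finset.sum_eq_zero fun σ _ => ?_
    rw [permMat, if_neg, smul_zero]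
    intro h'
    refine h fun i' hi' => funext fun k => ?_
    simpa [hi'] using h' i' k

theorem not_linearIndependent_phi {r : ℕ} (n : Fin r → ℕ) {m : ℕ} (γ : (M : Sub m) → Shuffle M)
    (i : Fin r) (hi : n i < m) :
    ¬ LinearIndependent ℂ fun x : Sub m × (Fin r → Equiv.Perm (Fin m)) => phi n (γ x.1) x.2 := by
  intro hli
  obtain ⟨M⟩ : Nonempty (Sub m) := by
    obtain ⟨s, hs⟩ := Finset.exists_subset_card_eq (s := (Finset.univ : Finset (Fin (2 * m))))
      (n := m) (by simp; omega)
    exact ⟨⟨s, hs.2⟩⟩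
  -- Fixing one `M` and varying only the `i`-th permutation gives a subfamily on which the signs
  -- form a relation; its coefficient at the identity is 1, not 0.
  have h := hli.comp (fun σ : Equiv.Perm (Fin m) => (M, Function.update 1 i σ)) fun σ τ h =>
    Function.update_injective _ i (congrArg Prod.snd h)
  have h1 := Fintype.linearIndependent_iffₛ.mp h (fun σ => ((Equiv.Perm.sign σ : ℤ) : ℂ)) 0 ?_ 1
  · simp at h1
  · simp only [Pi.zero_apply, zero_smul, Finset.sum_const_zero]
    refine IsBalanced.ext ?_ (fun _ _ _ => by simp) γ fun M' => ?_
    · intro b q hb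
      simp only [map_sum, map_smul, Finsupp.finsetSum_apply, Finsupp.smul_apply,
        Function.comp_apply]
      exact Finset.sum_eq_zero fun σ _ => by rw [isBalanced_phi n (γ M) _ b q hb, smul_zero]
    · simp only [map_sum, map_smul, Function.comp_apply, coeffMat_phi, map_zero]
      split_ifs
      · exact sum_sign_permMat i hi
      · simp

theorem card_phi_index (m r : ℕ) : Fintype.card (Sub m × (Fin r → Equiv.Perm (Fin m))) =
    (2 * m).choose m * m.factorial ^ r := by
  rw [Fintype.card_prod, Fintype.card_finset_len, Fintype.card_fin, Fintype.card_fun,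
    Fintype.card_perm, Fintype.card_fin, Fintype.card_fin]

end InvTensor

end

theorem mainTheorem3 (m r : ℕ) (hr : 1 ≤ r) (n : Fin r → ℕ) (hn : ∀ i, 1 ≤ n i) :
    (∀ γ : (M : InvTensor.Sub m) → InvTensor.Shuffle M,
      Submodule.span ℂ (Set.range
          fun x : InvTensor.Sub m × (Fin r → Equiv.Perm (Fin m)) =>
            InvTensor.phi n (γ x.1) x.2)
        = (InvTensor.invT n (2 * m)) ∧
      ((∀ i, m ≤ n i) →
        LinearIndependent ℂ
          fun x : InvTensor.Sub m × (Fin r → Equiv.Perm (Fin m)) =>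
            InvTensor.phi n (γ x.1) x.2)) ∧
    Module.finrank ℂ (InvTensor.invT n (2 * m))
      ≤ (2 * m).choose m * m.factorial ^ r ∧
    (Module.finrank ℂ (InvTensor.invT n (2 * m))
        = (2 * m).choose m * m.factorial ^ r ↔ ∀ i, m ≤ n i) := by
  refine ⟨fun γ => ⟨InvTensor.span_phi_eq_invT hr n γ, InvTensor.linearIndependent_phi n γ⟩, ?_⟩
  -- The dimension does not involve `γ`, so any choice serves. A finite spanning family is
  -- independent exactly when its size is the dimension of its span.
  let γ : (M : InvTensor.Sub m) → InvTensor.Shuffle M := fun M => Classical.arbitrary _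
  rw [← InvTensor.span_phi_eq_invT hr n γ, ← InvTensor.card_phi_index]
  refine ⟨finrank_range_le_card _, fun h => ?_, fun h => ?_⟩
  · by_contra! h'
    obtain ⟨i, hi⟩ := h'
    exact InvTensor.not_linearIndependent_phi n γ i hi
      (linearIndependent_iff_card_eq_finrank_span.mpr h.symm)
  · exact (linearIndependent_iff_card_eq_finrank_span.mp
      (InvTensor.linearIndependent_phi n γ h)).symm
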